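/- Let $\upsilon$ be an injective map from a real Lie algebra $\mathcal O$ to the (possibly unbounded) self-adjoint operators on a complex Hilbert space $\mathcal H$, and let $\mathbf V$ be the poset (under inclusion) of commutative von Neumann algebras of bounded operators on $\mathcal H$. For $V\in\mathbf V$ let $\flat(V)\subseteq V$ be the least von Neumann algebra containing all $e^{i\upsilon(a)}$, $a\in\mathcal O$, with $e^{i\upsilon(a)}\in V$. Let $J$ be the Grothendieck topology on $\mathbf V$ in which a sieve on $V$ covers iff it contains $\flat(V)$; sheaves on $\mathbf V$ are sheaves for $J$. For a presheaf $Q$ on $\mathbf V$ put $(\flat^*Q)(V)=Q(\flat(V))$, and let $Q_{\downarrow V}\subseteq Q$ be equal to $Q$ at all $V'\subseteq V$ and empty elsewhere; for a subpresheaf $A$ of $Q$ or of $Q_{\downarrow W}$, $A_{\downarrow V}$ denotes $A\cap Q_{\downarrow V}$. As $\flat\flat=\flat$, we identify $\flat^*\flat^*Q$ with $\flat^*Q$. Let $O$ be the outer presheaf: $O(V)$ is the set of projections in $V$, and for $V'\subseteq V$ the restriction $O(V)\to O(V')$ sends $P$ to $\bigwedge\{\alpha\in O(V') : P\le\alpha\}$.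 Let $\mathbb P_{dB}O$ be the presheaf whose value at $V$ is the set $\mathrm{Sub}_{dB}(O_{\downarrow V})$ of all subpresheaves $A\subseteq O_{\downarrow V}$ such that $A(V')$ is, for every $V'\subseteq V$, a downward closed subset of $O(V')$ with a top element; its restriction maps are $A\mapsto A_{\downarrow V'}$. Let $\mathbb P_{j\,dB}(\flat^*O)$ be the presheaf whose value at $V$ is the set $\mathrm{Sub}_{j\,dB}(\flat^*(O_{\downarrow V}))$ of all subsheaves $A\subseteq\flat^*(O_{\downarrow V})$ such that $A(V')$ is downward closed with a top element whenever $\flat(V')\subseteq V$; its restriction maps are $A\mapsto\flat^*(A_{\downarrow V'})$. Let $\varrho_O:\flat^*(\mathbb P_{dB}O)\to\mathbb P_{j\,dB}(\flat^*O)$ be the morphism with components $A\mapsto\flat^*A$. A filter in $\mathrm{Sub}_{dB}(O_{\downarrow V})$ or $\mathrm{Sub}_{j\,dB}(\flat^*(O_{\downarrow V}))$ is a subset, possibly empty, that is upward closed and closed under binary intersections. A truth presheaf is a subpresheaf $\mathbb T$ of $\mathbb P_{dB}O$ such that every $\mathbb T(V)$ is a filter, and a truth sheaf is a subsheaf $\mathbb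 T_j$ of $\mathbb P_{j\,dB}(\flat^*O)$ such that every $\mathbb T_j(V)$ is a filter. Truth presheaves are ordered by inclusion and form a lattice, where $(\mathbb T_1\wedge\mathbb T_2)(V)=\mathbb T_1(V)\cap\mathbb T_2(V)$ and $(\mathbb T_1\vee\mathbb T_2)(V)$ is the smallest filter including $\mathbb T_1(V)\cup\mathbb T_2(V)$. For a truth sheaf $\mathbb T_j$, let $\boldsymbol\jmath(\mathbb T_j)$ be the set of all truth presheaves $\mathbb T$ with $\flat^*\mathbb T=\varrho_O^{-1}(\mathbb T_j)$ (the translations of $\mathbb T_j$). Define truth presheaves $\boldsymbol\jmath^\vee(\mathbb T_j)$ and $\boldsymbol\jmath^\wedge(\mathbb T_j)$ by $$\boldsymbol\jmath^\vee(\mathbb T_j)(V)=\{A\in\mathrm{Sub}_{dB}(O_{\downarrow V}) : \flat^*A\in\mathbb T_j(V)\},$$ and by letting $\boldsymbol\jmath^\wedge(\mathbb T_j)(V)$ be the smallest filter in $\mathrm{Sub}_{dB}(O_{\downarrow V})$ including all $A_{\downarrow V}$ with $A\in\varrho_O^{-1}(\mathbb T_j)(W)$, $W\in\mathcal U^\flat(V)=\{W\in\mathbf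 V : V\subseteq\flat(W)\}$ (it is empty if $\mathcal U^\flat(V)$ is). Theorem. For every truth sheaf $\mathbb T_j$, the set $\boldsymbol\jmath(\mathbb T_j)$ is a non-empty sublattice of the lattice of truth presheaves, and $$\boldsymbol\jmath(\mathbb T_j)=\{\mathbb T\text{ a truth presheaf} : \boldsymbol\jmath^\wedge(\mathbb T_j)\subseteq\mathbb T\subseteq\boldsymbol\jmath^\vee(\mathbb T_j)\}.$$ -/

import Mathlib

open CategoryTheory Opposite
open scoped InnerProductSpace

noncomputable section

/-! ## Commutative von Neumann algebras and their projections -/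

section VonNeumann

variable (H : Type*) [NormedAddCommGroup H] [InnerProductSpace ℂ H] [CompleteSpace H]

/-- The poset `𝐕` of commutative von Neumann algebras of bounded operators on `H`, ordered by
inclusion (and hence a category). The algebra of scalars is included. -/
abbrev CommVN : Type _ :=
  {V : VonNeumannAlgebra H // ∀ x ∈ V, ∀ y ∈ V, x * y = y * x}

variable {H}

/-- The least von Neumann algebra containing a set `S` of bounded operators: the double commutant
of `S ∪ S*`. -/
def vnGenerated (S : Set (H →L[ℂ] H)) : VonNeumannAlgebra H where
  toStarSubalgebra := StarSubalgebra.centralizer ℂ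
    (StarSubalgebra.centralizer ℂ S : Set (H →L[ℂ] H))
  centralizer_centralizer' := by
    have h : ∀ T : StarSubalgebra ℂ (H →L[ℂ] H),
        ((StarSubalgebra.centralizer ℂ (T : Set (H →L[ℂ] H)) : StarSubalgebra ℂ _) :
          Set (H →L[ℂ] H)) = Set.centralizer (T : Set (H →L[ℂ] H)) := by
      intro T
      rw [StarSubalgebra.coe_centralizer]
      congr 1
      refine Set.union_eq_self_of_subset_right fun x hx => ?_
      have := star_mem (s := T) (Set.mem_star.1 hx)
      simpa using this
    change Set.centralizer (Set.centralizer
      (StarSubalgebra.centralizer ℂ (StarSubalgebra.centralizer ℂ S : Set (H →L[ℂ] H)) :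
        Set (H →L[ℂ] H))) =
      (StarSubalgebra.centralizer ℂ (StarSubalgebra.centralizer ℂ S : Set (H →L[ℂ] H)) :
        Set (H →L[ℂ] H))
    rw [h, Set.centralizer_centralizer_centralizer]

theorem subset_vnGenerated (S : Set (H →L[ℂ] H)) : S ⊆ (vnGenerated S : Set (H →L[ℂ] H)) := by
  intro x hx
  change x ∈ StarSubalgebra.centralizer ℂ (StarSubalgebra.centralizer ℂ S : Set (H →L[ℂ] H))
  rw [StarSubalgebra.mem_centralizer_iff]
  intro g hg
  have h1 := (StarSubalgebra.mem_centralizer_iff ℂ).1 (SetLike.mem_coe.1 hg) x hx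
  have h2 := (StarSubalgebra.mem_centralizer_iff ℂ).1
    (star_mem (SetLike.mem_coe.1 hg)) x hx
  exact ⟨h1.1.symm, h2.1.symm⟩

theorem vnGenerated_le {S : Set (H →L[ℂ] H)} {V : VonNeumannAlgebra H}
    (h : S ⊆ (V : Set (H →L[ℂ] H))) : vnGenerated S ≤ V := by
  intro x hx
  change x ∈ StarSubalgebra.centralizer ℂ (StarSubalgebra.centralizer ℂ S : Set (H →L[ℂ] H)) at hx
  rw [← SetLike.mem_coe, ← V.centralizer_centralizer, Set.mem_centralizer_iff]
  intro g hg
  refine ((StarSubalgebra.mem_centralizer_iff ℂ).1 hx g ?_).1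
  rw [SetLike.mem_coe, StarSubalgebra.mem_centralizer_iff]
  intro s hs
  exact ⟨hg s (h hs), hg (star s) (star_mem (S := VonNeumannAlgebra H) (h hs))⟩

/-- The set `𝒫(V)` of projection operators in `V`. -/
def Proj (V : CommVN H) : Type _ :=
  {P : H →L[ℂ] H // IsStarProjection P ∧ P ∈ V.1}

/-- The usual order of projections, i.e. the operator order. -/
instance (V : CommVN H) : PartialOrder (Proj V) :=
  inferInstanceAs (PartialOrder {P : H →L[ℂ] H // IsStarProjection P ∧ P ∈ V.1})

theorem proj_le_iff_range_le {p q : H →L[ℂ] H} (hp : IsStarProjection p)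
    (hq : IsStarProjection q) : p ≤ q ↔ p.range ≤ q.range := by
  rw [hp.le_iff_mul_eq_right hq]
  constructor
  · rintro h _ ⟨x, rfl⟩
    exact ⟨p x, by simpa using congrArg (fun f : H →L[ℂ] H => f x) h⟩
  · intro h
    ext x
    obtain ⟨y, hy⟩ := h (LinearMap.mem_range_self _ x : p x ∈ p.range)
    have hy' : q y = p x := hy
    have := congrArg (fun f : H →L[ℂ] H => f y) hq.isIdempotentElem
    change q (q y) = q y at this
    change q (p x) = p x
    rw [← hy', this]

/-- The intersection of the ranges of a family of projections. -/
def infRange {V : CommVN H} (S : Set (Proj V)) : Submodule ℂ H :=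
  ⨅ p ∈ S, (p.1 : H →L[ℂ] H).range

theorem isClosed_infRange {V : CommVN H} (S : Set (Proj V)) :
    IsClosed (infRange S : Set H) := by
  simp only [infRange, Submodule.coe_iInf]
  refine isClosed_iInter fun p => isClosed_iInter fun _ => ?_
  exact ContinuousLinearMap.IsIdempotentElem.isClosed_range p.2.1.isIdempotentElem

instance {V : CommVN H} (S : Set (Proj V)) : CompleteSpace (infRange S) :=
  (isClosed_infRange S).completeSpace_coe

/-- The meet `⋀ S` of a family of projections in `V`: the projection onto the intersection of the
ranges. -/
instance (V : CommVN H) : InfSet (Proj V) where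
  sInf S := ⟨(infRange S).starProjection, isStarProjection_starProjection, by
    rw [VonNeumannAlgebra.IsStarProjection.mem_iff isStarProjection_starProjection]
    intro y hy
    rw [Submodule.range_starProjection]
    rw [Module.End.mem_invtSubmodule]
    intro x hx
    simp only [infRange, Submodule.mem_comap, Submodule.mem_iInf] at hx ⊢
    intro p hp
    have := (VonNeumannAlgebra.IsStarProjection.mem_iff p.2.1 V.1).1 p.2.2 y hy
    rw [Module.End.mem_invtSubmodule] at this
    exact this (hx p hp)⟩

/-- The projections of `V` form a complete lattice. -/
instance (V : CommVN H) : CompleteLattice (Proj V) :=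
  completeLatticeOfInf _ fun S => by
    have key : ∀ p q : Proj V, p ≤ q ↔ (p.1 : H →L[ℂ] H).range ≤ (q.1 : H →L[ℂ] H).range :=
      fun p q => proj_le_iff_range_le p.2.1 q.2.1
    have hr : ((sInf S : Proj V).1 : H →L[ℂ] H).range = infRange S :=
      Submodule.range_starProjection _
    refine ⟨fun p hp => ?_, fun q hq => ?_⟩
    · rw [key, hr]
      exact iInf₂_le p hp
    · rw [key, hr]
      exact le_iInf₂ fun p hp => (key _ _).1 (hq hp)

/-- Daseinization: `δ(P)_V = ⋀ {α ∈ 𝒫(V) | P ≤ α}`. -/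
def dasein (P : H →L[ℂ] H) (V : CommVN H) : Proj V :=
  sInf {α : Proj V | P ≤ α.1}

theorem dasein_le_iff {W V : CommVN H} (P : Proj W) (h : V ≤ W) (α : Proj V) :
    dasein P.1 V ≤ α ↔ P.1 ≤ α.1 := by
  constructor
  · intro hα
    let β : Proj V → Proj W := fun γ => ⟨γ.1, γ.2.1, h γ.2.2⟩
    have h1 : P ≤ β (dasein P.1 V) := by
      change P.1 ≤ (dasein P.1 V).1
      rw [proj_le_iff_range_le P.2.1 (dasein P.1 V).2.1]
      change _ ≤ ((infRange _).starProjection : H →L[ℂ] H).range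
      rw [Submodule.range_starProjection]
      exact le_iInf₂ fun γ hγ => (proj_le_iff_range_le P.2.1 γ.2.1).1 hγ
    exact le_trans (show P.1 ≤ (dasein P.1 V).1 from h1) hα
  · intro hα
    exact sInf_le hα

variable (H) in
/-- The outer presheaf `O`: `O(V) = 𝒫(V)`, with restriction `P ↦ δ(P)_{V'}`. -/
def outer : (CommVN H)ᵒᵖ ⥤ Type _ where
  obj V := Proj V.unop
  map {V V'} _ := TypeCat.ofHom fun P : Proj V.unop => dasein P.1 V'.unop
  map_id V := by
    ext P
    exact eq_of_forall_ge_iff fun α => dasein_le_iff (V := V.unop) P le_rfl α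
  map_comp {V V' V''} f g := by
    ext P
    refine eq_of_forall_ge_iff fun α => ?_
    change dasein P.1 V''.unop ≤ α ↔ dasein (dasein P.1 V'.unop).1 V''.unop ≤ α
    have hf : V'.unop ≤ V.unop := leOfHom f.unop
    have hg : V''.unop ≤ V'.unop := leOfHom g.unop
    rw [dasein_le_iff P (hg.trans hf), dasein_le_iff (dasein P.1 V'.unop) hg]
    exact (dasein_le_iff P hf (⟨α.1, α.2.1, hg α.2.2⟩ : Proj V'.unop)).symm

/-- The restriction map `Q(V' ↪ V)` of a presheaf. -/
def resOf (Q : (CommVN H)ᵒᵖ ⥤ Type*) {V V' : CommVN H} (h : V' ≤ V) :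
    Q.obj (op V) → Q.obj (op V') :=
  Q.map (homOfLE h).op

theorem resOf_self (Q : (CommVN H)ᵒᵖ ⥤ Type*) {V : CommVN H} (h : V ≤ V) (q : Q.obj (op V)) :
    resOf Q h q = q := by
  change Q.map (𝟙 (op V)) q = q
  rw [Q.map_id]
  rfl

theorem resOf_resOf (Q : (CommVN H)ᵒᵖ ⥤ Type*) {V V' V'' : CommVN H} (h : V' ≤ V) (h' : V'' ≤ V')
    (q : Q.obj (op V)) : resOf Q h' (resOf Q h q) = resOf Q (h'.trans h) q := by
  change _ = Q.map ((homOfLE h).op ≫ (homOfLE h').op) q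
  rw [Q.map_comp]
  rfl

theorem resOf_mem {Q : (CommVN H)ᵒᵖ ⥤ Type*} (S : Subfunctor Q) {V V' : CommVN H} (h : V' ≤ V)
    {q : Q.obj (op V)} (hq : q ∈ S.obj (op V)) : resOf Q h q ∈ S.obj (op V') :=
  S.map (homOfLE h).op hq

/-- The downward restriction `Q_{↓V}`, as a subpresheaf of `Q`: it equals `Q` on the `V' ⊆ V` and is
empty elsewhere. Subobjects of `Q_{↓V}` are the subpresheaves of `Q` contained in it. -/
def down (Q : (CommVN H)ᵒᵖ ⥤ Type*) (V : CommVN H) : Subfunctor Q where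
  obj V' := {_q | V'.unop ≤ V}
  map f _ h := (leOfHom f.unop).trans h

theorem down_mono (Q : (CommVN H)ᵒᵖ ⥤ Type*) {V V' : CommVN H} (h : V' ≤ V) :
    down Q V' ≤ down Q V :=
  fun _ _ h' => le_trans h' h

/-- A set of projections in `V` is downward closed with a top element. -/
def IsDB {V : CommVN H} (S : Set (Proj V)) : Prop :=
  IsLowerSet S ∧ ∃ a, IsGreatest S a

theorem IsDB.inter {V : CommVN H} {S T : Set (Proj V)} (hS : IsDB S) (hT : IsDB T) :
    IsDB (S ∩ T) := by
  obtain ⟨hS, a, ha, ha'⟩ := hS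
  obtain ⟨hT, b, hb, hb'⟩ := hT
  exact ⟨hS.inter hT, a ⊓ b, ⟨hS inf_le_left ha, hT inf_le_right hb⟩,
    fun c hc => le_inf (ha' hc.1) (hb' hc.2)⟩

/-- `Sub_dB(O_{↓V})`: the subpresheaves `A` of `O_{↓V}` such that every `A(V')`, `V' ⊆ V`, is
downward closed with a top element. -/
def SubDB (V : CommVN H) : Type _ :=
  {A : Subfunctor (outer H) //
    A ≤ down (outer H) V ∧ ∀ V' : CommVN H, V' ≤ V → IsDB (V := V') (A.obj (op V'))}

/-- Subpresheaves are ordered by inclusion, and the meet is the intersection. -/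
instance (V : CommVN H) : SemilatticeInf (SubDB V) :=
  Subtype.semilatticeInf fun _ _ hA hB =>
    ⟨inf_le_left.trans hA.1, fun V' h => (hA.2 V' h).inter (hB.2 V' h)⟩

/-- The restriction `A ↦ A_{↓V'}` for `V' ⊆ V`. -/
def SubDB.restrict {V V' : CommVN H} (h : V' ≤ V) (A : SubDB V) : SubDB V' :=
  ⟨A.1 ⊓ down (outer H) V', inf_le_right, fun W hW => by
    have : (A.1 ⊓ down (outer H) V').obj (op W) = A.1.obj (op W) :=
      Set.inter_eq_left.2 fun _ _ => hW
    rw [this]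
    exact A.2.2 W (hW.trans h)⟩

variable (H) in
/-- The presheaf `ℙ_dB O`: `V ↦ Sub_dB(O_{↓V})`, with restriction `A ↦ A_{↓V'}`. -/
def PdB : (CommVN H)ᵒᵖ ⥤ Type _ where
  obj V := SubDB V.unop
  map f := TypeCat.ofHom (SubDB.restrict (leOfHom f.unop))
  map_id V := by
    ext A
    exact Subtype.ext (inf_eq_left.2 A.2.1)
  map_comp {V V' V''} f g := by
    ext A
    refine Subtype.ext ?_
    change A.1 ⊓ down (outer H) V''.unop =
      (A.1 ⊓ down (outer H) V'.unop) ⊓ down (outer H) V''.unop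
    rw [inf_assoc, inf_eq_right.2 (down_mono (outer H) (leOfHom g.unop))]

end VonNeumann

/-! ## Filters -/

section Filters

/-- A filter in a meet-semilattice: an upward closed set that is closed under binary meets. The
empty set counts as a filter. -/
def IsFilt {L : Type*} [SemilatticeInf L] (F : Set L) : Prop :=
  (∀ a ∈ F, ∀ b, a ≤ b → b ∈ F) ∧ ∀ a ∈ F, ∀ b ∈ F, a ⊓ b ∈ F

/-- The smallest filter including `R`. It is empty if `R` is. -/
def genFilt {L : Type*} [SemilatticeInf L] (R : Set L) : Set L :=
  {a | ∀ F : Set L, IsFilt F → R ⊆ F → a ∈ F}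

variable {L : Type*} [SemilatticeInf L]

theorem isFilt_genFilt (R : Set L) : IsFilt (genFilt R) :=
  ⟨fun a ha b hab F hF hR => hF.1 a (ha F hF hR) b hab,
    fun a ha b hb F hF hR => hF.2 a (ha F hF hR) b (hb F hF hR)⟩

theorem subset_genFilt (R : Set L) : R ⊆ genFilt R := fun _ ha _ _ hR => hR ha

theorem genFilt_le {R F : Set L} (hF : IsFilt F) (h : R ⊆ F) : genFilt R ⊆ F :=
  fun _ ha => ha F hF h

theorem IsFilt.inter {F G : Set L} (hF : IsFilt F) (hG : IsFilt G) : IsFilt (F ∩ G) :=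
  ⟨fun a ha b hab => ⟨hF.1 a ha.1 b hab, hG.1 a ha.2 b hab⟩,
    fun a ha b hb => ⟨hF.2 a ha.1 b hb.1, hG.2 a ha.2 b hb.2⟩⟩

theorem IsFilt.preimage {L' : Type*} [SemilatticeInf L'] {F : Set L'} (hF : IsFilt F)
    (f : L → L') (hf : Monotone f) (hf' : ∀ a b, f (a ⊓ b) = f a ⊓ f b) : IsFilt (f ⁻¹' F) :=
  ⟨fun a ha b hab => hF.1 (f a) ha (f b) (hf hab), fun a ha b hb => by
    rw [Set.mem_preimage, hf']; exact hF.2 _ ha _ hb⟩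

end Filters

/-! ## Truth presheaves -/

section TruthPresheaves

variable (H : Type*) [NormedAddCommGroup H] [InnerProductSpace ℂ H] [CompleteSpace H]

/-- A truth presheaf: a subpresheaf `𝕋` of `ℙ_dB O` such that every `𝕋(V)` is a filter. -/
structure TruthPresheaf where
  toSub : Subfunctor (PdB H)
  isFilt : ∀ V : CommVN H, IsFilt (L := SubDB V) (toSub.obj (op V))

variable {H}

theorem SubDB.restrict_mono {V V' : CommVN H} (h : V' ≤ V) :
    Monotone (SubDB.restrict h) :=
  fun A B hAB => (inf_le_inf_right (down (outer H) V') hAB :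
    A.1 ⊓ down (outer H) V' ≤ B.1 ⊓ down (outer H) V')

theorem SubDB.restrict_inf {V V' : CommVN H} (h : V' ≤ V) (A B : SubDB V) :
    SubDB.restrict h (A ⊓ B) = SubDB.restrict h A ⊓ SubDB.restrict h B :=
  Subtype.ext (inf_inf_distrib_right A.1 B.1 (down (outer H) V'))

/-- Families `R V ⊆ Sub_dB(O_{↓V})` that are stable under restriction generate a truth presheaf
with components the smallest filters including `R V`. -/
def TruthPresheaf.generate (R : ∀ V : CommVN H, Set (SubDB V))
    (hR : ∀ (V V' : CommVN H) (h : V' ≤ V), ∀ A ∈ R V, SubDB.restrict h A ∈ R V') :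
    TruthPresheaf H where
  toSub :=
    { obj := fun V => genFilt (L := SubDB V.unop) (R V.unop)
      map := fun {V V'} f => by
        have h : V'.unop ≤ V.unop := leOfHom f.unop
        exact genFilt_le ((isFilt_genFilt (R V'.unop)).preimage (SubDB.restrict h)
          (SubDB.restrict_mono h) (SubDB.restrict_inf h))
          fun A hA => subset_genFilt _ (hR _ _ h A hA) }
  isFilt V := isFilt_genFilt _

/-- Truth presheaves are ordered by inclusion. -/
instance : PartialOrder (TruthPresheaf H) :=
  PartialOrder.lift TruthPresheaf.toSub fun S T h => by cases S; cases T; cases h; rfl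

/-- The lattice of truth presheaves: `(𝕋₁ ∧ 𝕋₂)(V) = 𝕋₁(V) ∩ 𝕋₂(V)`, and `(𝕋₁ ∨ 𝕋₂)(V)` is the
smallest filter including `𝕋₁(V) ∪ 𝕋₂(V)`. -/
instance : Lattice (TruthPresheaf H) where
  inf S T := ⟨S.toSub ⊓ T.toSub, fun V => (S.isFilt V).inter (T.isFilt V)⟩
  inf_le_left S T := (inf_le_left : S.toSub ⊓ T.toSub ≤ S.toSub)
  inf_le_right S T := (inf_le_right : S.toSub ⊓ T.toSub ≤ T.toSub)
  le_inf R S T h h' := (le_inf h h' : R.toSub ≤ S.toSub ⊓ T.toSub)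
  sup S T := TruthPresheaf.generate
    (fun V => S.toSub.obj (op V) ∪ T.toSub.obj (op V)) fun _ _ h _ hA =>
      hA.imp (fun hA => S.toSub.map (homOfLE h).op hA) fun hA => T.toSub.map (homOfLE h).op hA
  le_sup_left _ _ V _ hA := subset_genFilt (L := SubDB V.unop) _ (Or.inl hA)
  le_sup_right _ _ V _ hA := subset_genFilt (L := SubDB V.unop) _ (Or.inr hA)
  sup_le _ _ R h h' V _ hA := genFilt_le (R.isFilt V.unop) (Set.union_subset (h V) (h' V)) hA

end TruthPresheaves

/-! ## Quantization and the functor `♭` -/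

section Quantization

/-- `U` is the strongly continuous one-parameter unitary group `t ↦ e^{itA}` generated by the
(possibly unbounded) operator `A`: its derivative at `0` exists exactly at the vectors of the
domain of `A`, and is `i A` there. -/
structure IsUnitaryGroupOf {H : Type*} [NormedAddCommGroup H] [InnerProductSpace ℂ H]
    [CompleteSpace H] (A : H →ₗ.[ℂ] H) (U : ℝ → H →L[ℂ] H) : Prop where
  unitary : ∀ t, U t ∈ unitary (H →L[ℂ] H)
  zero : U 0 = 1
  add : ∀ s t, U (s + t) = U s * U t
  continuous : ∀ x, Continuous fun t => U t x
  generator : ∀ x y, (x, y) ∈ A.graph ↔ HasDerivAt (fun t => U t x) (Complex.I • y) 0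

open Classical in
/-- The unitary operator `e^{iA}` for a self-adjoint operator `A` (the group in question exists and
is unique by Stone's theorem; the value for other operators `A` is irrelevant). -/
def expI {H : Type*} [NormedAddCommGroup H] [InnerProductSpace ℂ H] [CompleteSpace H]
    (A : H →ₗ.[ℂ] H) : H →L[ℂ] H :=
  if h : ∃ U : ℝ → H →L[ℂ] H, IsUnitaryGroupOf A U then h.choose 1 else 1

/-- A quantization: an injective map `υ` from a Lie algebra `𝔬` of classical observables to the
self-adjoint (possibly unbounded) operators on a Hilbert space `H`. -/
structure Quantization (𝔬 : Type*) [LieRing 𝔬] [LieAlgebra ℝ 𝔬] (H : Type*)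
    [NormedAddCommGroup H] [InnerProductSpace ℂ H] [CompleteSpace H] where
  toFun : 𝔬 → H →ₗ.[ℂ] H
  isSelfAdjoint : ∀ a, IsSelfAdjoint (toFun a)
  injective : Function.Injective toFun

namespace Quantization

variable {𝔬 : Type*} [LieRing 𝔬] [LieAlgebra ℝ 𝔬] {H : Type*}
  [NormedAddCommGroup H] [InnerProductSpace ℂ H] [CompleteSpace H] (υ : Quantization 𝔬 H)

/-- `φ(C)`: the least von Neumann algebra that includes `e^{iυ(C)}`. -/
def phi (C : Set 𝔬) : VonNeumannAlgebra H :=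
  vnGenerated ((fun a => expI (υ.toFun a)) '' C)

/-- `ψ(V) = {a | e^{iυ(a)} ∈ V}`. -/
def psi (V : CommVN H) : Set 𝔬 :=
  {a | expI (υ.toFun a) ∈ V.1}

theorem phi_psi_le (V : CommVN H) : υ.phi (υ.psi V) ≤ V.1 :=
  vnGenerated_le (by rintro _ ⟨a, ha, rfl⟩; exact ha)

/-- `♭(V) = φ(ψ(V))`. -/
def flat (V : CommVN H) : CommVN H :=
  ⟨υ.phi (υ.psi V), fun x hx y hy => V.2 x (υ.phi_psi_le V hx) y (υ.phi_psi_le V hy)⟩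

theorem flat_le (V : CommVN H) : υ.flat V ≤ V := υ.phi_psi_le V

theorem flat_mono {V W : CommVN H} (h : V ≤ W) : υ.flat V ≤ υ.flat W :=
  have h' : υ.psi V ⊆ υ.psi W := fun _ ha => h ha
  vnGenerated_le (Set.Subset.trans (Set.image_mono h') (subset_vnGenerated _))

theorem le_flat_flat (V : CommVN H) : υ.flat V ≤ υ.flat (υ.flat V) := by
  refine vnGenerated_le (Set.Subset.trans ?_ (subset_vnGenerated _))
  exact Set.image_mono fun a ha => subset_vnGenerated _ (Set.mem_image_of_mem _ ha)

theorem flat_flat (V : CommVN H) : υ.flat (υ.flat V) = υ.flat V :=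
  le_antisymm (υ.flat_le _) (υ.le_flat_flat V)

/-- The Grothendieck topology `J(V) = {ω | ♭(V) ∈ ω}` on `𝐕`. -/
def topology : GrothendieckTopology (CommVN H) where
  sieves V := {ω | ω (homOfLE (υ.flat_le V))}
  top_mem' _ := trivial
  pullback_stable' {V W} ω f h := by
    have := ω.downward_closed h (homOfLE (υ.flat_mono (leOfHom f)))
    exact this
  transitive' {V} ω h R hR := by
    have h1 := hR h
    have h2 := R.downward_closed h1 (homOfLE (υ.le_flat_flat V))
    exact h2

/-- A presheaf is a `j`-sheaf. -/
abbrev IsJSheaf (Q : (CommVN H)ᵒᵖ ⥤ Type*) : Prop := Presieve.IsSheaf υ.topology Q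

/-- The functor `♭^*` on presheaves: `(♭^*Q)(V) = Q(♭(V))`. -/
def flatStar (Q : (CommVN H)ᵒᵖ ⥤ Type*) : (CommVN H)ᵒᵖ ⥤ Type _ where
  obj V := Q.obj (op (υ.flat V.unop))
  map f := Q.map (homOfLE (υ.flat_mono (leOfHom f.unop))).op
  map_id _ := Q.map_id _
  map_comp _ _ := Q.map_comp _ _

/-- `♭^*` on subpresheaves: `(♭^*S)(V) = S(♭(V))`, a subpresheaf of `♭^*Q` for `S ⊆ Q`. -/
def flatSub {Q : (CommVN H)ᵒᵖ ⥤ Type*} (S : Subfunctor Q) : Subfunctor (υ.flatStar Q) where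
  obj V := S.obj (op (υ.flat V.unop))
  map f := S.map (homOfLE (υ.flat_mono (leOfHom f.unop))).op

/-- The natural morphism `ζ_Q : Q ⟶ ♭^*Q`, `(ζ_Q)_V = Q(♭(V) ↪ V)`. -/
def zeta (Q : (CommVN H)ᵒᵖ ⥤ Type*) : Q ⟶ υ.flatStar Q where
  app V := Q.map (homOfLE (υ.flat_le V.unop)).op
  naturality V W f := by
    have h : W.unop ≤ V.unop := leOfHom f.unop
    ext q
    exact (resOf_resOf Q h (υ.flat_le W.unop) q).trans
      (resOf_resOf Q (υ.flat_le V.unop) (υ.flat_mono h) q).symm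

theorem flatStar_isJSheaf (Q : (CommVN H)ᵒᵖ ⥤ Type*) : υ.IsJSheaf (υ.flatStar Q) := by
  intro V ω hω x hx
  have hω' : ω (homOfLE (υ.flat_le V)) := hω
  let t₀ : Q.obj (op (υ.flat (υ.flat V))) := x _ hω'
  refine ⟨resOf Q (υ.le_flat_flat V) t₀, ?_, ?_⟩
  · intro W f hf
    have h1 : resOf Q (υ.flat_mono (υ.flat_le W)) (x f hf) =
        resOf Q (υ.flat_mono (υ.flat_mono (leOfHom f))) t₀ :=
      hx (homOfLE (υ.flat_le W)) (homOfLE (υ.flat_mono (leOfHom f))) hf hω'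
        (Subsingleton.elim _ _)
    have h2 := congrArg (resOf Q (υ.le_flat_flat W)) h1
    have h3 := (resOf_resOf Q (υ.flat_mono (υ.flat_le W)) (υ.le_flat_flat W) (x f hf)).symm.trans
      (h2.trans (resOf_resOf Q (υ.flat_mono (υ.flat_mono (leOfHom f))) (υ.le_flat_flat W) t₀))
    exact (resOf_resOf Q (υ.le_flat_flat V) (υ.flat_mono (leOfHom f)) t₀).trans
      (h3.symm.trans (resOf_self Q _ (x f hf)))
  · intro t ht
    have h1 : resOf Q (υ.flat_mono (υ.flat_le V)) t = t₀ := ht _ hω'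
    rw [← h1]
    exact ((resOf_resOf Q (υ.flat_mono (υ.flat_le V)) (υ.le_flat_flat V) t).trans
      (resOf_self Q _ t)).symm

/-- The closure of a subpresheaf `S` of `Q`:
`S̄(V) = {q ∈ Q(V) | Q(♭(V) ↪ V)(q) ∈ S(♭(V))}`, i.e. the pullback of `♭^*S` along `ζ_Q`.
For a subpresheaf `S` of a presheaf `♭^*Q`, the presheaf `♭^*S` is a priori a subpresheaf of
`♭^*♭^*Q`. Since `♭♭ = ♭`, the latter is identified with `♭^*Q` along `ζ`, and then `♭^*S` is the
closure of `S` in `♭^*Q`. -/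
def closure {Q : (CommVN H)ᵒᵖ ⥤ Type*} (S : Subfunctor Q) : Subfunctor Q :=
  (υ.flatSub S).preimage (υ.zeta Q)

theorem mem_closure {Q : (CommVN H)ᵒᵖ ⥤ Type*} (S : Subfunctor Q) {V : CommVN H}
    (q : Q.obj (op V)) :
    q ∈ (υ.closure S).obj (op V) ↔ resOf Q (υ.flat_le V) q ∈ S.obj (op (υ.flat V)) := Iff.rfl

theorem isJSheaf_toFunctor_iff {Q : (CommVN H)ᵒᵖ ⥤ Type*} (hQ : υ.IsJSheaf Q)
    (S : Subfunctor Q) : υ.IsJSheaf S.toFunctor ↔ υ.closure S = S := by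
  rw [IsJSheaf, Subfunctor.isSheaf_iff _ hQ]
  constructor
  · intro h
    refine le_antisymm (fun V q hq => ?_) fun V q hq => ?_
    · exact h V q hq
    · exact (υ.mem_closure S q).2 (resOf_mem S _ hq)
  · intro h V q hq
    have : q ∈ (υ.closure S).obj V := hq
    rwa [h] at this

/-- `Sub_{j dB}(♭^*(O_{↓V}))`: the subsheaves `A` of `♭^*(O_{↓V})` such that every `A(V')`
with `♭(V') ⊆ V` (that is, wherever `♭^*(O_{↓V})` is not empty) is downward closed with a top
element. -/
def SubJDB (V : CommVN H) : Type _ :=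
  {A : Subfunctor (υ.flatStar (outer H)) //
    A ≤ υ.flatSub (down (outer H) V) ∧ υ.IsJSheaf A.toFunctor ∧
      ∀ V' : CommVN H, υ.flat V' ≤ V → IsDB (V := υ.flat V') (A.obj (op V'))}

theorem closure_inf {Q : (CommVN H)ᵒᵖ ⥤ Type*} (S T : Subfunctor Q) :
    υ.closure (S ⊓ T) = υ.closure S ⊓ υ.closure T := rfl

/-- Subsheaves are ordered by inclusion, and the meet is the intersection. -/
instance (V : CommVN H) : SemilatticeInf (υ.SubJDB V) :=
  Subtype.semilatticeInf fun A B hA hB =>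
    ⟨inf_le_left.trans hA.1, by
      rw [isJSheaf_toFunctor_iff υ (υ.flatStar_isJSheaf _), closure_inf,
        (isJSheaf_toFunctor_iff υ (υ.flatStar_isJSheaf _) A).1 hA.2.1,
        (isJSheaf_toFunctor_iff υ (υ.flatStar_isJSheaf _) B).1 hB.2.1],
      fun V' h => (hA.2.2 V' h).inter (hB.2.2 V' h)⟩

theorem closure_down (Q : (CommVN H)ᵒᵖ ⥤ Type*) (V : CommVN H) :
    υ.closure (down (υ.flatStar Q) V) = υ.flatSub (down Q V) := rfl

theorem closure_flatSub {Q : (CommVN H)ᵒᵖ ⥤ Type*} (S : Subfunctor Q) :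
    υ.closure (υ.flatSub S) = υ.flatSub S := by
  refine le_antisymm (fun V q hq => ?_) fun V q hq => ?_
  · have hq' : resOf Q (υ.flat_mono (υ.flat_le V.unop)) q ∈
        S.obj (op (υ.flat (υ.flat V.unop))) := hq
    have h := resOf_mem S (υ.le_flat_flat V.unop) hq'
    have h2 := (resOf_resOf Q (υ.flat_mono (υ.flat_le V.unop)) (υ.le_flat_flat V.unop) q).trans
      (resOf_self Q _ q)
    rwa [h2] at h
  · exact resOf_mem S (υ.flat_mono (υ.flat_le V.unop)) hq

theorem flatSub_isJSheaf {Q : (CommVN H)ᵒᵖ ⥤ Type*} (S : Subfunctor Q) :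
    υ.IsJSheaf (υ.flatSub S).toFunctor :=
  (isJSheaf_toFunctor_iff υ (υ.flatStar_isJSheaf Q) _).2 (υ.closure_flatSub S)

theorem closure_inf_down {V : CommVN H} (A : υ.SubJDB V) (V' : CommVN H) :
    υ.closure (A.1 ⊓ down (υ.flatStar (outer H)) V') = A.1 ⊓ υ.flatSub (down (outer H) V') := by
  rw [closure_inf, closure_down,
    (isJSheaf_toFunctor_iff υ (υ.flatStar_isJSheaf _) A.1).1 A.2.2.1]

/-- The restriction `A ↦ ♭^*(A_{↓V'})` for `V' ⊆ V`. (As a subpresheaf of `♭^*O`, the presheaf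
`♭^*(A_{↓V'})` is the closure of `A_{↓V'}`, because `♭♭ = ♭`.) -/
def SubJDB.restrict {V V' : CommVN H} (h : V' ≤ V) (A : υ.SubJDB V) : υ.SubJDB V' :=
  ⟨υ.closure (A.1 ⊓ down (υ.flatStar (outer H)) V'), by
    rw [closure_inf_down]
    refine ⟨inf_le_right, ?_, fun W hW => ?_⟩
    · rw [isJSheaf_toFunctor_iff υ (υ.flatStar_isJSheaf _), closure_inf, closure_flatSub,
        (isJSheaf_toFunctor_iff υ (υ.flatStar_isJSheaf _) A.1).1 A.2.2.1]
    · have : (A.1 ⊓ υ.flatSub (down (outer H) V')).obj (op W) = A.1.obj (op W) :=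
        Set.inter_eq_left.2 fun _ _ => hW
      rw [this]
      exact A.2.2.2 W (hW.trans h)⟩

theorem flatSub_mono {Q : (CommVN H)ᵒᵖ ⥤ Type*} {S T : Subfunctor Q} (h : S ≤ T) :
    υ.flatSub S ≤ υ.flatSub T := fun V => h (op (υ.flat V.unop))

/-- The presheaf `ℙ_{j dB}(♭^*O)`: `V ↦ Sub_{j dB}(♭^*(O_{↓V}))`, with restriction
`A ↦ ♭^*(A_{↓V'})`. -/
def PjdB : (CommVN H)ᵒᵖ ⥤ Type _ where
  obj V := υ.SubJDB V.unop
  map f := TypeCat.ofHom (SubJDB.restrict υ (leOfHom f.unop))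
  map_id V := by
    ext A
    refine Subtype.ext ?_
    change υ.closure (A.1 ⊓ down _ _) = A.1
    rw [closure_inf_down]
    exact inf_eq_left.2 A.2.1
  map_comp {V V' V''} f g := by
    ext A
    refine Subtype.ext ?_
    change υ.closure (A.1 ⊓ down _ V''.unop) =
      υ.closure ((SubJDB.restrict υ (leOfHom f.unop) A).1 ⊓ down _ V''.unop)
    rw [closure_inf_down, closure_inf_down]
    change _ = υ.closure (A.1 ⊓ down _ V'.unop) ⊓ _
    rw [closure_inf_down, inf_assoc,
      inf_eq_right.2 (υ.flatSub_mono (down_mono (outer H) (leOfHom g.unop)))]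

/-- A truth sheaf: a subsheaf `𝕋_j` of `ℙ_{j dB}(♭^*O)` such that every `𝕋_j(V)` is a filter. -/
structure TruthSheaf where
  toSub : Subfunctor υ.PjdB
  isJSheaf : υ.IsJSheaf toSub.toFunctor
  isFilt : ∀ V : CommVN H, IsFilt (L := υ.SubJDB V) (toSub.obj (op V))

/-! ## Translations of truth sheaves -/

theorem flatSub_down_flat (Q : (CommVN H)ᵒᵖ ⥤ Type*) (V : CommVN H) :
    υ.flatSub (down Q (υ.flat V)) = υ.flatSub (down Q V) := by
  refine le_antisymm (υ.flatSub_mono (down_mono Q (υ.flat_le V))) fun W q hq => ?_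
  have h : υ.flat W.unop ≤ V := hq
  exact (υ.le_flat_flat W.unop).trans (υ.flat_mono h)

/-- The map `Sub_dB(O_{↓V}) → Sub_{j dB}(♭^*(O_{↓V}))`, `A ↦ ♭^*A`. -/
def sheafify (V : CommVN H) (A : SubDB V) : υ.SubJDB V :=
  ⟨υ.flatSub A.1, υ.flatSub_mono A.2.1, υ.flatSub_isJSheaf A.1, fun _ h => A.2.2 _ h⟩

/-- The morphism `ϱ_O : ♭^*(ℙ_dB O) ⟶ ℙ_{j dB}(♭^*O)`. Its component at `V` sends
`A ∈ Sub_dB(O_{↓♭(V)})` to `♭^*A`, a subsheaf of `♭^*(O_{↓♭(V)}) = ♭^*(O_{↓V})`. -/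
def rho : υ.flatStar (PdB H) ⟶ υ.PjdB where
  app V := TypeCat.ofHom fun A : SubDB (υ.flat V.unop) =>
    (⟨υ.flatSub A.1, (υ.flatSub_mono A.2.1).trans (υ.flatSub_down_flat _ _).le,
      υ.flatSub_isJSheaf A.1,
      fun V' h => A.2.2 _ ((υ.le_flat_flat V').trans (υ.flat_mono h))⟩ : υ.SubJDB V.unop)
  naturality V V' f := by
    ext A
    refine Subtype.ext ?_
    let B : SubDB (υ.flat V.unop) := A
    change υ.flatSub (B.1 ⊓ down (outer H) (υ.flat V'.unop)) =
      υ.closure (υ.flatSub B.1 ⊓ down (υ.flatStar (outer H)) V'.unop)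
    rw [closure_inf, closure_flatSub, closure_down, ← flatSub_down_flat]
    rfl

/-- `ϱ_O^{-1}(𝕋_j)`, a subpresheaf of `♭^*(ℙ_dB O)`. -/
def rhoInv (T : υ.TruthSheaf) : Subfunctor (υ.flatStar (PdB H)) :=
  T.toSub.preimage υ.rho

/-- The set `𝒋(𝕋_j)` of all translations of `𝕋_j`: the truth presheaves `𝕋` such that
`♭^*𝕋 = ϱ_O^{-1}(𝕋_j)`. -/
def translations (T : υ.TruthSheaf) : Set (TruthPresheaf H) :=
  {S | υ.flatSub S.toSub = υ.rhoInv T}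

theorem sheafify_mono (V : CommVN H) : Monotone (υ.sheafify V) :=
  fun _ _ h => υ.flatSub_mono h

theorem sheafify_restrict {V V' : CommVN H} (h : V' ≤ V) (A : SubDB V) :
    υ.sheafify V' (A.restrict h) = SubJDB.restrict υ h (υ.sheafify V A) := by
  refine Subtype.ext ?_
  change υ.flatSub (A.1 ⊓ down (outer H) V') =
    υ.closure (υ.flatSub A.1 ⊓ down (υ.flatStar (outer H)) V')
  rw [closure_inf, closure_flatSub, closure_down]
  rfl

/-- The truth presheaf `𝒋^∨(𝕋_j)`, `𝒋^∨(𝕋_j)(V) = {A ∈ Sub_dB(O_{↓V}) | ♭^*A ∈ 𝕋_j(V)}`. -/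
def jMax (T : υ.TruthSheaf) : TruthPresheaf H where
  toSub :=
    { obj := fun V => {A : SubDB V.unop | υ.sheafify V.unop A ∈ T.toSub.obj V}
      map := fun {V V'} f A hA => by
        have h : SubJDB.restrict υ (leOfHom f.unop) (υ.sheafify V.unop A) ∈ T.toSub.obj V' :=
          T.toSub.map f hA
        exact (congrArg (· ∈ T.toSub.obj V')
          (υ.sheafify_restrict (leOfHom f.unop) (show SubDB V.unop from A))).mpr h }
  isFilt V := (T.isFilt V).preimage (υ.sheafify V) (υ.sheafify_mono V) fun _ _ => rfl

/-- `𝒰^♭(V) = {W | V ⊆ ♭(W)}`. -/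
def upFlat (V : CommVN H) : Set (CommVN H) := {W | V ≤ υ.flat W}

/-- `ℝ_V = ⋃_{W ∈ 𝒰^♭(V)} ℝ_{V;W}`, where `ℝ_{V;W} = {A_{↓V} | A ∈ ϱ_O^{-1}(𝕋_j)(W)}`. -/
def restrictions (T : υ.TruthSheaf) (V : CommVN H) : Set (SubDB V) :=
  {B | ∃ (W : CommVN H) (hW : W ∈ υ.upFlat V) (A : SubDB (υ.flat W)),
    A ∈ (υ.rhoInv T).obj (op W) ∧ SubDB.restrict hW A = B}

/-- The truth presheaf `𝒋^∧(𝕋_j)`: `𝒋^∧(𝕋_j)(V)` is the smallest filter in `Sub_dB(O_{↓V})`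
including `ℝ_V`. (It is empty if `𝒰^♭(V)` is.) -/
def jMin (T : υ.TruthSheaf) : TruthPresheaf H :=
  TruthPresheaf.generate (υ.restrictions T) fun V V' h B hB => by
    obtain ⟨W, hW, A, hA, rfl⟩ := hB
    refine ⟨W, h.trans hW, A, hA, Subtype.ext ?_⟩
    change A.1 ⊓ down (outer H) V' = (A.1 ⊓ down (outer H) V) ⊓ down (outer H) V'
    rw [inf_assoc, inf_eq_right.2 (down_mono (outer H) h)]

end Quantization

end Quantization

end

/-!
The translations of a truth sheaf `𝕋_j` are exactly the truth presheaves between `𝒋^∧(𝕋_j)` and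
`𝒋^∨(𝕋_j)`; both ends of the interval are forced by the values on the algebras `♭(V)`.

A subsheaf `A` of `♭^*(O_{↓V})` already lies in `♭^*(O_{↓♭(V)})`, so restricting it from `V` to
`♭(V)` does not change it (`restrict_flat_val`). Hence `ℙ_{j dB}(♭^*O)` is separated, and
membership in the subsheaf `𝕋_j` can be tested at `♭(V)` (`mem_of_restrict_flat_mem`). Because the
components of `ϱ_O` and of `A ↦ ♭^*A` differ only by such restrictions, this gives
`♭^*(𝒋^∨(𝕋_j)) = ϱ_O^{-1}(𝕋_j)` (`jMax_mem_translations`), and every translation is contained in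
`𝒋^∨(𝕋_j)` (`le_jMax_of_mem_translations`). On the other side, `𝒋^∧(𝕋_j)` is generated by the
restrictions of elements of `ϱ_O^{-1}(𝕋_j)(W) = 𝕋(♭(W))`, which every translation `𝕋` contains
(`jMin_le_of_mem_translations`). Finally a truth presheaf between the two has the right values
at every `♭(V)`, because `♭(V) ∈ 𝒰^♭(♭(V))` puts `ϱ_O^{-1}(𝕋_j)(V)` inside `𝒋^∧(𝕋_j)(♭(V))`. An
order interval is a sublattice.
-/

theorem SubDB.restrict_self {H : Type*} [NormedAddCommGroup H] [InnerProductSpace ℂ H]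
    [CompleteSpace H] {V : CommVN H} (h : V ≤ V) (A : SubDB V) : SubDB.restrict h A = A :=
  Subtype.ext (inf_eq_left.2 A.2.1)

namespace Quantization

variable {𝔬 : Type*} [LieRing 𝔬] [LieAlgebra ℝ 𝔬] {H : Type*}
  [NormedAddCommGroup H] [InnerProductSpace ℂ H] [CompleteSpace H] (υ : Quantization 𝔬 H)

/-- Restriction from `V` to `♭(V)` leaves the underlying subpresheaf of `♭^*O` unchanged, since
`♭^*(O_{↓♭(V)}) = ♭^*(O_{↓V})`. -/
theorem restrict_flat_val {V : CommVN H} (A : υ.SubJDB V) :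
    (SubJDB.restrict υ (υ.flat_le V) A).1 = A.1 := by
  change υ.closure (A.1 ⊓ down (υ.flatStar (outer H)) (υ.flat V)) = A.1
  rw [closure_inf_down, flatSub_down_flat]
  exact inf_eq_left.2 A.2.1

/-- Membership in a truth sheaf can be tested on `♭(V)`. The sheaf condition provides a section
over `V` with the given restriction to `♭(V)`, and `restrict_flat_val` identifies it. -/
theorem mem_of_restrict_flat_mem (T : υ.TruthSheaf) {V : CommVN H} (A : υ.SubJDB V)
    (hA : SubJDB.restrict υ (υ.flat_le V) A ∈ T.toSub.obj (op (υ.flat V))) :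
    A ∈ T.toSub.obj (op V) := by
  let q : υ.PjdB.obj (op V) := A
  have hcov : T.toSub.sieveOfSection q ∈ υ.topology V := hA
  obtain ⟨t, ht, -⟩ := T.isJSheaf _ hcov _ (T.toSub.family_of_elements_compatible q)
  have h : SubJDB.restrict υ (υ.flat_le V) t.1 = SubJDB.restrict υ (υ.flat_le V) A :=
    congrArg Subtype.val (ht (homOfLE (υ.flat_le V)) hA)
  have hval : (show υ.SubJDB V from t.1) = A := by
    refine Subtype.ext ?_
    rw [← υ.restrict_flat_val A, ← h]
    exact (υ.restrict_flat_val _).symm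
  exact hval ▸ t.2

/-- The component of `ϱ_O` at `V`, restricted to `♭(V)`, is `A ↦ ♭^*A` on `Sub_dB(O_{↓♭(V)})`. -/
theorem restrict_rho (V : CommVN H) (A : SubDB (υ.flat V)) :
    SubJDB.restrict υ (υ.flat_le V) (υ.rho.app (op V) A) = υ.sheafify (υ.flat V) A :=
  Subtype.ext (υ.restrict_flat_val _)

/-- The component of `ϱ_O` at `V`, applied to `A_{↓♭(V)}`, is `♭^*A`. -/
theorem rho_restrict (V : CommVN H) (A : SubDB V) :
    υ.rho.app (op V) (SubDB.restrict (υ.flat_le V) A) = υ.sheafify V A := by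
  refine Subtype.ext ?_
  change υ.flatSub A.1 ⊓ υ.flatSub (down (outer H) (υ.flat V)) = υ.flatSub A.1
  rw [flatSub_down_flat]
  exact inf_eq_left.2 (υ.flatSub_mono A.2.1)

theorem jMax_mem_translations (T : υ.TruthSheaf) : υ.jMax T ∈ υ.translations T := by
  refine Subfunctor.ext (funext fun V => Set.ext fun (A : SubDB (υ.flat V.unop)) => ?_)
  change υ.sheafify (υ.flat V.unop) A ∈ T.toSub.obj (op (υ.flat V.unop)) ↔
    υ.rho.app (op V.unop) A ∈ T.toSub.obj (op V.unop)
  rw [← restrict_rho]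
  exact ⟨υ.mem_of_restrict_flat_mem T _,
    fun h => T.toSub.map (homOfLE (υ.flat_le V.unop)).op h⟩

theorem mem_iff_of_mem_translations {T : υ.TruthSheaf} {S : TruthPresheaf H}
    (hS : S ∈ υ.translations T) (V : CommVN H) (A : SubDB (υ.flat V)) :
    A ∈ S.toSub.obj (op (υ.flat V)) ↔ A ∈ (υ.rhoInv T).obj (op V) := by
  have h : υ.flatSub S.toSub = υ.rhoInv T := hS
  rw [← h]
  rfl

theorem le_jMax_of_mem_translations {T : υ.TruthSheaf} {S : TruthPresheaf H}
    (hS : S ∈ υ.translations T) : S ≤ υ.jMax T := by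
  intro V (A : SubDB V.unop) hA
  have h := (υ.mem_iff_of_mem_translations hS V.unop _).1
    (S.toSub.map (homOfLE (υ.flat_le V.unop)).op hA)
  have h' : υ.rho.app (op V.unop) (SubDB.restrict (υ.flat_le V.unop) A) ∈
    T.toSub.obj (op V.unop) := h
  rwa [rho_restrict] at h'

theorem jMin_le_of_mem_translations {T : υ.TruthSheaf} {S : TruthPresheaf H}
    (hS : S ∈ υ.translations T) : υ.jMin T ≤ S := by
  intro V
  refine genFilt_le (L := SubDB V.unop) (S.isFilt V.unop) ?_
  rintro _ ⟨W, hW, A, hA, rfl⟩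
  exact S.toSub.map (homOfLE hW).op ((υ.mem_iff_of_mem_translations hS W A).2 hA)

theorem rhoInv_subset_jMin (T : υ.TruthSheaf) (V : CommVN H) (A : SubDB (υ.flat V))
    (hA : A ∈ (υ.rhoInv T).obj (op V)) : A ∈ (υ.jMin T).toSub.obj (op (υ.flat V)) :=
  subset_genFilt (L := SubDB (υ.flat V)) _
    ⟨V, le_refl (υ.flat V), A, hA, SubDB.restrict_self _ A⟩

theorem translations_eq_Icc (T : υ.TruthSheaf) :
    υ.translations T = Set.Icc (υ.jMin T) (υ.jMax T) := by
  refine Set.Subset.antisymm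
    (fun S hS => ⟨υ.jMin_le_of_mem_translations hS, υ.le_jMax_of_mem_translations hS⟩) ?_
  rintro S ⟨hmin, hmax⟩
  refine Subfunctor.ext (funext fun V => Set.ext fun (A : SubDB (υ.flat V.unop)) => ?_)
  exact ⟨fun h => (υ.mem_iff_of_mem_translations (υ.jMax_mem_translations T) V.unop A).1
    (hmax _ h), fun h => hmin _ (υ.rhoInv_subset_jMin T V.unop A h)⟩

end Quantization

theorem mainTheorem3 {𝔬 : Type*} [LieRing 𝔬] [LieAlgebra ℝ 𝔬] {H : Type*}
    [NormedAddCommGroup H] [InnerProductSpace ℂ H] [CompleteSpace H]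
    (υ : Quantization 𝔬 H) (T : υ.TruthSheaf) :
    (υ.translations T).Nonempty ∧ IsSublattice (υ.translations T) ∧
      υ.translations T = {S : TruthPresheaf H | υ.jMin T ≤ S ∧ S ≤ υ.jMax T} := by
  refine ⟨⟨_, υ.jMax_mem_translations T⟩, ?_, υ.translations_eq_Icc T⟩
  rw [υ.translations_eq_Icc]
  exact ⟨fun _ hR _ hS => ⟨hR.1.trans le_sup_left, sup_le hR.2 hS.2⟩,
    fun _ hR _ hS => ⟨le_inf hR.1 hS.1, inf_le_left.trans hR.2⟩⟩
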